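/- Let $D\subset\mathbb R^d$ be compact and let $E\subseteq\mathbb R^d$ be a convex set with $D\subseteq E$, relative to which complements and boundaries are taken (so $E=\mathbb R^d$ for arbitrary compact $D$, or $E=D$ if $D$ is itself convex). For $A\subseteq E$ put $A^c=E\setminus A$ and let $$b_A(x)=d_A(x)-d_{A^c}(x),\qquad d_B(x)=\inf_{y\in B}|x-y|,\qquad x\in D,$$ be the oriented distance function of $A$. Let $\mathbf A$ be a random closed set (closed-set valued, with $\{\mathbf A\cap K\ne\emptyset\}$ measurable for every compact $K\subset\mathbb R^d$) which is almost surely contained in $E$ and has nonempty boundary $\partial\mathbf A$ relative to $E$, and suppose that $E[b_{\mathbf A}(x_0)^2]<\infty$ for some $x_0\in D$. Let $\mathbb Z=\{\mathbb Z(x)\}_{x\in D}$ be the limiting field: the Gaussian random field on $D$ with mean zero and covariance $$\mathrm{cov}(\mathbb Z(x),\mathbb Z(y))=E[b_{\mathbf A}(x)b_{\mathbf A}(y)]-E[b_{\mathbf A}(x)]\,E[b_{\mathbf A}(y)],\qquad x,y\in D.$$ It is the limit of the empirical fluctuations in the following sense: if the random closed sets $\mathbf A_1,\mathbf A_2,\dots$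 (almost surely contained in $E$ and with nonempty boundary) are such that $b_{\mathbf A_1},b_{\mathbf A_2},\dots$ are independent random functions on $D$ with the law of $b_{\mathbf A}$, and if $\sqrt n\,\bigl(\frac1n\sum_{i=1}^n b_{\mathbf A_i}(\cdot)-E[b_{\mathbf A}(\cdot)]\bigr)$ converges weakly in $C(D)$ to a random element $\mathbb Z$ of $C(D)$, then $\mathbb Z$ is Gaussian with this mean and covariance. Moreover, for every Gaussian random field $\mathbb Z$ on $D$ with this mean and covariance, and for all $x,y,x',y'\in D$, $$\mathrm{var}(\mathbb Z(x)-\mathbb Z(y))\le|x-y|^2,$$ $$|\mathrm{cov}(\mathbb Z(y)-\mathbb Z(x),\mathbb Z(y')-\mathbb Z(x'))|\le 2\,|y-x|\,|y'-x'| .$$ The sample paths of $\mathbb Z$ are Lipschitz of order $\alpha$ for every $\alpha\in(0,1)$: there is a modification of $\mathbb Z$ all of whose paths $f$ satisfy, for every $\alpha\in(0,1)$, $|f(x)-f(y)|\le K|x-y|^\alpha$ for all $x,y\in D$ with some finite $K>0$ (depending on the path and on $\alpha$); and if $\mathbb Z$ has almost surely continuous paths, then almost surely the paths of $\mathbb Z$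 themselves have this property. -/

import Mathlib

open MeasureTheory ProbabilityTheory Filter Topology

noncomputable section

/-- The Euclidean space `ℝ^d`, with the Euclidean norm. -/
abbrev Euc (d : ℕ) : Type := EuclideanSpace ℝ (Fin d)

/-- The oriented distance function `b_A(x) = d_A(x) - d_{A^c}(x)`, where the complement
`A^c = E \ A` is taken in the ambient set `E` and `d_B(x) = inf_{y ∈ B} |x - y|`. -/
def odf {d : ℕ} (E A : Set (Euc d)) (x : Euc d) : ℝ :=
  Metric.infDist x A - Metric.infDist x (E \ A)

/-- The boundary of `A`, relative to the ambient set `E`, when `A ⊆ E`. -/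
def relBoundary {d : ℕ} (E A : Set (Euc d)) : Set (Euc d) :=
  E ∩ (closure A ∩ closure (E \ A))

/-- Random closed sets in `ℝ^d`: closed-set valued maps such that hitting a compact set is
always a measurable event. -/
structure IsRandomClosedSet {d : ℕ} {Ω : Type*} [MeasurableSpace Ω] (A : Ω → Set (Euc d)) :
    Prop where
  isClosed : ∀ ω, IsClosed (A ω)
  measurableSet_hit : ∀ K : Set (Euc d), IsCompact K → MeasurableSet {ω | (A ω ∩ K).Nonempty}

/-- A random closed set which is almost surely contained in `E` and has, relative to `E`, a
nonempty boundary; these are the random sets for which the oriented distance function is used. -/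
structure IsRandomSetIn {d : ℕ} {Ω : Type*} [MeasurableSpace Ω] (E : Set (Euc d))
    (A : Ω → Set (Euc d)) (P : Measure Ω) : Prop where
  isRandomClosedSet : IsRandomClosedSet A
  subset : ∀ᵐ ω ∂P, A ω ⊆ E
  boundary_nonempty : ∀ᵐ ω ∂P, (relBoundary E (A ω)).Nonempty

/-- The Borel σ-algebra of `C(D)`; for compact `D` the topology of `C(D)` is that of uniform
convergence on `D`. -/
instance instMeasurableSpaceCD {d : ℕ} {D : Set (Euc d)} : MeasurableSpace C(D, ℝ) := borel _

instance instBorelSpaceCD {d : ℕ} {D : Set (Euc d)} : BorelSpace C(D, ℝ) := ⟨rfl⟩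

/-- The random function `ω ↦ b_{A(ω)}`, restricted to the observation window `D`. -/
def odfOn {d : ℕ} {Ω : Type*} (E D : Set (Euc d)) (A : Ω → Set (Euc d)) (ω : Ω) (x : D) : ℝ :=
  odf E (A ω) x

/-- `As 0, As 1, …` are independent copies of the random set `A`, in the sense that their oriented
distance functions are i.i.d. random functions on `D` with the same law as that of `A`. -/
structure IsIIDSample {d : ℕ} {Ω Ω₁ : Type*} [MeasurableSpace Ω] [MeasurableSpace Ω₁]
    (E D : Set (Euc d)) (A : Ω → Set (Euc d)) (P : Measure Ω)
    (As : ℕ → Ω₁ → Set (Euc d)) (P₁ : Measure Ω₁) : Prop where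
  isRandomSetIn : ∀ i, IsRandomSetIn E (As i) P₁
  indep : iIndepFun (fun i => odfOn E D (As i)) P₁
  identDistrib : ∀ i, IdentDistrib (odfOn E D (As i)) (odfOn E D A) P₁ P

/-- The fluctuation field
`Z_n(x) = √n (n⁻¹ ∑_{i < n} b_{A_i}(x) - E[b_A(x)])`. -/
def fluctuation {d : ℕ} {Ω Ω₁ : Type*} [MeasurableSpace Ω]
    (E D : Set (Euc d)) (A : Ω → Set (Euc d)) (P : Measure Ω)
    (As : ℕ → Ω₁ → Set (Euc d)) (n : ℕ) (ω : Ω₁) (x : D) : ℝ :=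
  Real.sqrt n * ((n : ℝ)⁻¹ * ∑ i ∈ Finset.range n, odfOn E D (As i) ω x
    - ∫ ω', odfOn E D A ω' x ∂P)

/-- `Z` is a Gaussian random field on `D` with mean zero and covariance
`cov(Z(x), Z(y)) = E[b_A(x) b_A(y)] - E[b_A(x)] E[b_A(y)]`. -/
structure IsLimitField {d : ℕ} {Ω Ω' : Type*} [MeasurableSpace Ω] [MeasurableSpace Ω']
    (E D : Set (Euc d)) (A : Ω → Set (Euc d)) (P : Measure Ω)
    (Z : D → Ω' → ℝ) (P' : Measure Ω') : Prop where
  isGaussian : IsGaussianProcess Z P'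
  mean_zero : ∀ x, ∫ ω, Z x ω ∂P' = 0
  covariance_eq : ∀ x y, cov[Z x, Z y; P'] =
    ∫ ω, odfOn E D A ω x * odfOn E D A ω y ∂P
      - (∫ ω, odfOn E D A ω x ∂P) * ∫ ω, odfOn E D A ω y ∂P

/-- `f` is Lipschitz of order `α` on its domain `D`. -/
def LipschitzOfOrder {d : ℕ} {D : Set (Euc d)} (α : ℝ) (f : D → ℝ) : Prop :=
  ∃ K : ℝ, 0 < K ∧ ∀ x y : D, |f x - f y| ≤ K * ‖(x : Euc d) - y‖ ^ α

end

/-! Everything rests on one deterministic fact, `abs_odf_sub_odf_le`: on a convex ambient set the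
function `b_A` is 1-Lipschitz. Only points on opposite sides of `A` need an argument, and for them
the segment joining them crosses the boundary. Increments of `b_A` are thus bounded by the distance,
and since `Z` has the covariance of `b_A`, both second-moment bounds carry over to `Z`.

A weak limit is identified by its linear statistics: a finite combination of point values is
continuous on `C(D)`, and along the fluctuation fields it is a normalized centred i.i.d. sum. The
one-dimensional central limit theorem and uniqueness of limits in law give a Gaussian with the right
variance (`map_sum_limit_eq_gaussianReal`).

Path regularity is a Kolmogorov–Chentsov chaining argument. A centred Gaussian increment with
standard deviation at most `|x - y|` has tails `C (|x - y| / ε) ^ p` for every `p`. A net of mesh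
`2⁻ⁿ` in `D` has `O(2^{nd})` points, so for `α < 1` and `p` large a union bound and Borel–Cantelli
bound all neighbouring increments by `2^{-nα}` from some level on. Chaining
(`exists_limit_of_chain`) makes the values along the nets converge to a Hölder function, which
agrees with `Z` almost surely at each point. -/

/-! ### Lipschitz continuity of the oriented distance function -/

/-- If `x` lies in the closed set `A` and `y` in its relative complement, the segment from `x` to
`y` meets the relative boundary of `A`. -/
lemma exists_mem_segment_mem_closure_diff {d : ℕ} {E A : Set (Euc d)} (hE : Convex ℝ E)
    (hA : IsClosed A) {x y : Euc d} (hx : x ∈ E) (hy : y ∈ E) (hxA : x ∈ A) (hyA : y ∉ A) :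
    ∃ z ∈ segment ℝ x y, z ∈ A ∧ z ∈ closure (E \ A) := by
  have hcov : segment ℝ x y ⊆ A ∪ closure (E \ A) := fun z hz => by
    by_cases hzA : z ∈ A
    · exact .inl hzA
    · exact .inr (subset_closure ⟨hE.segment_subset hx hy hz, hzA⟩)
  obtain ⟨z, hz, h⟩ := isPreconnected_closed_iff.1 (convex_segment x y).isPreconnected A
    (closure (E \ A)) hA isClosed_closure hcov ⟨x, left_mem_segment ℝ x y, hxA⟩
    ⟨y, right_mem_segment ℝ x y, subset_closure ⟨hy, hyA⟩⟩
  exact ⟨z, hz, h⟩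

lemma odf_of_mem {d : ℕ} {E A : Set (Euc d)} {x : Euc d} (hx : x ∈ A) :
    odf E A x = -Metric.infDist x (E \ A) := by
  simp [odf, Metric.infDist_zero_of_mem hx]

lemma odf_of_notMem {d : ℕ} {E A : Set (Euc d)} {x : Euc d} (hxE : x ∈ E) (hx : x ∉ A) :
    odf E A x = Metric.infDist x A := by
  simp [odf, Metric.infDist_zero_of_mem (show x ∈ E \ A from ⟨hxE, hx⟩)]

lemma abs_infDist_sub_infDist_le {X : Type*} [PseudoMetricSpace X] (s : Set X) (x y : X) :
    |Metric.infDist x s - Metric.infDist y s| ≤ dist x y := by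
  have h := (Metric.lipschitz_infDist_pt s).dist_le_mul x y
  simpa [Real.dist_eq] using h

/-- A boundary point `z` on the segment bounds the depth of `x` by `dist x z` and the height of `y`
by `dist z y`. The two values of `b_A` have opposite signs, so the increment is the sum of depth and
height, and the two bounds add up to exactly `dist x y`. -/
lemma abs_odf_sub_odf_le_of_mem_of_notMem {d : ℕ} {E A : Set (Euc d)} (hE : Convex ℝ E)
    (hA : IsClosed A) {x y : Euc d} (hx : x ∈ E) (hy : y ∈ E) (hxA : x ∈ A) (hyA : y ∉ A) :
    |odf E A x - odf E A y| ≤ dist x y := by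
  obtain ⟨z, hz, hzA, hzc⟩ := exists_mem_segment_mem_closure_diff hE hA hx hy hxA hyA
  rw [odf_of_mem hxA, odf_of_notMem hy hyA, ← dist_add_dist_of_mem_segment hz]
  have h1 : Metric.infDist x (E \ A) ≤ dist x z := by
    rw [← Metric.infDist_closure]
    exact Metric.infDist_le_dist_of_mem hzc
  have h2 : Metric.infDist y A ≤ dist z y := by
    rw [dist_comm]
    exact Metric.infDist_le_dist_of_mem hzA
  have h3 := Metric.infDist_nonneg (x := x) (s := E \ A)
  have h4 := Metric.infDist_nonneg (x := y) (s := A)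
  rw [abs_le]
  constructor <;> linarith

/-- The oriented distance function of a closed set is `1`-Lipschitz on the convex ambient set. -/
lemma abs_odf_sub_odf_le {d : ℕ} {E A : Set (Euc d)} (hE : Convex ℝ E)
    (hA : IsClosed A) {x y : Euc d} (hx : x ∈ E) (hy : y ∈ E) :
    |odf E A x - odf E A y| ≤ dist x y := by
  by_cases hxA : x ∈ A <;> by_cases hyA : y ∈ A
  · rw [odf_of_mem hxA, odf_of_mem hyA, neg_sub_neg, abs_sub_comm]
    exact abs_infDist_sub_infDist_le _ _ _
  · exact abs_odf_sub_odf_le_of_mem_of_notMem hE hA hx hy hxA hyA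
  · rw [abs_sub_comm, dist_comm]
    exact abs_odf_sub_odf_le_of_mem_of_notMem hE hA hy hx hyA hxA
  · rw [odf_of_notMem hx hxA, odf_of_notMem hy hyA]
    exact abs_infDist_sub_infDist_le _ _ _

/-! ### Measurability of the oriented distance function -/

namespace IsRandomClosedSet

variable {d : ℕ} {Ω : Type*} [MeasurableSpace Ω] {A : Ω → Set (Euc d)}

lemma measurableSet_mem (hA : IsRandomClosedSet A) (x : Euc d) :
    MeasurableSet {ω | x ∈ A ω} := by
  simpa using hA.measurableSet_hit {x} isCompact_singleton

/-- The distance to a nonempty closed set is attained, so it is at most `r` exactly when the set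
hits the compact ball of radius `r`. -/
lemma measurable_infEDist (hA : IsRandomClosedSet A) (x : Euc d) :
    Measurable fun ω => Metric.infEDist x (A ω) := by
  refine measurable_of_Iic fun r => ?_
  rcases eq_or_ne r ⊤ with rfl | hr
  · simp
  lift r to NNReal using hr
  convert hA.measurableSet_hit _ (isCompact_closedBall x r) using 1
  ext ω
  simp only [Set.mem_preimage, Set.mem_Iic, Set.mem_ofPred_eq]
  constructor
  · intro h
    have hne : (A ω).Nonempty := by
      by_contra hne
      rw [Set.not_nonempty_iff_eq_empty] at hne
      simp [hne] at h
    obtain ⟨y, hy, hxy⟩ := (hA.isClosed ω).exists_infDist_eq_dist hne x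
    refine ⟨y, hy, ?_⟩
    rw [Metric.mem_closedBall, dist_comm, ← hxy, Metric.infDist]
    exact ENNReal.toReal_le_coe_of_le_coe h
  · rintro ⟨y, hy, hxy⟩
    refine (Metric.infEDist_le_edist_of_mem hy).trans ?_
    rw [edist_comm, edist_nndist]
    exact_mod_cast hxy

/-- The complement is relatively open in `E`, so a countable dense `Q ⊆ E` has `Q \ A ω` dense in `E
\ A ω`. The distance becomes a countable infimum in which points of `A ω` are discarded by giving
them the value `⊤`. -/
lemma measurable_infEDist_diff (hA : IsRandomClosedSet A) (E : Set (Euc d)) (x : Euc d) :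
    Measurable fun ω => Metric.infEDist x (E \ A ω) := by
  classical
  obtain ⟨Q, hQE, hQc, hQ⟩ :=
    (TopologicalSpace.IsSeparable.of_separableSpace E).exists_countable_dense_subset
  have key : ∀ ω, Metric.infEDist x (E \ A ω) =
      ⨅ y ∈ Q, if y ∈ A ω then ⊤ else edist x y := fun ω => by
    have h1 : E \ A ω ⊆ closure (Q \ A ω) := fun y hy => by
      have h := (hA.isClosed ω).isOpen_compl.inter_closure ⟨hy.2, hQ hy.1⟩
      rwa [Set.inter_comm, ← Set.sdiff_eq] at h
    have h2 : Metric.infEDist x (E \ A ω) = Metric.infEDist x (Q \ A ω) :=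
      le_antisymm (Metric.infEDist_anti (Set.sdiff_subset_sdiff_left hQE))
        (Metric.infEDist_closure.symm.trans_le (Metric.infEDist_anti h1))
    rw [h2, Metric.infEDist]
    refine le_antisymm (le_iInf₂ fun y hy => ?_) (le_iInf₂ fun y hy => ?_)
    · split_ifs with h
      · exact le_top
      · exact iInf₂_le y ⟨hy, h⟩
    · refine (iInf₂_le y hy.1).trans_eq ?_
      simp [hy.2]
  simp_rw [key]
  refine Measurable.biInf Q hQc fun y _ => ?_
  exact Measurable.ite (hA.measurableSet_mem y) measurable_const measurable_const

lemma measurable_odf (hA : IsRandomClosedSet A) (E : Set (Euc d)) (x : Euc d) :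
    Measurable fun ω => odf E (A ω) x :=
  (hA.measurable_infEDist x).ennreal_toReal.sub (hA.measurable_infEDist_diff E x).ennreal_toReal

end IsRandomClosedSet

/-! ### Second moments of the oriented distance function -/

section SecondMoments

variable {d : ℕ} {E D : Set (Euc d)} {Ω : Type*} [MeasurableSpace Ω] {P : Measure Ω}
  {A : Ω → Set (Euc d)}

lemma abs_odfOn_sub_odfOn_le (hE : Convex ℝ E) (hDE : D ⊆ E) (hA : IsRandomClosedSet A)
    (ω : Ω) (x y : D) : |odfOn E D A ω x - odfOn E D A ω y| ≤ dist x y :=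
  abs_odf_sub_odf_le hE (hA.isClosed ω) (hDE x.2) (hDE y.2)

lemma measurable_odfOn_apply (hA : IsRandomClosedSet A) (x : D) :
    Measurable fun ω => odfOn E D A ω x := hA.measurable_odf E x

lemma memLp_odfOn_sub_odfOn [IsFiniteMeasure P] (hE : Convex ℝ E) (hDE : D ⊆ E)
    (hA : IsRandomClosedSet A) (x y : D) :
    MemLp (fun ω => odfOn E D A ω x - odfOn E D A ω y) 2 P :=
  MemLp.of_bound
    ((measurable_odfOn_apply hA x).sub (measurable_odfOn_apply hA y)).aestronglyMeasurable
    (dist x y) (.of_forall fun ω => abs_odfOn_sub_odfOn_le hE hDE hA ω x y)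

lemma memLp_odfOn [IsFiniteMeasure P] (hE : Convex ℝ E) (hDE : D ⊆ E)
    (hA : IsRandomClosedSet A) (hA2 : ∃ x₀ : D, MemLp (fun ω => odfOn E D A ω x₀) 2 P) (x : D) :
    MemLp (fun ω => odfOn E D A ω x) 2 P := by
  obtain ⟨x₀, h⟩ := hA2
  convert (memLp_odfOn_sub_odfOn hE hDE hA x x₀).add h using 1
  ext ω
  simp

lemma variance_odfOn_sub_odfOn_le [IsProbabilityMeasure P] (hE : Convex ℝ E) (hDE : D ⊆ E)
    (hA : IsRandomClosedSet A) (x y : D) :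
    Var[fun ω => odfOn E D A ω x - odfOn E D A ω y; P] ≤ dist x y ^ 2 := by
  have hm := memLp_odfOn_sub_odfOn (P := P) hE hDE hA x y
  refine (variance_le_expectation_sq hm.aestronglyMeasurable).trans ?_
  refine (integral_mono hm.integrable_sq (integrable_const (dist x y ^ 2)) fun ω => ?_).trans_eq
    (by simp)
  exact sq_le_sq.2 ((abs_odfOn_sub_odfOn_le hE hDE hA ω x y).trans (le_abs_self _))

end SecondMoments

/-! ### Identification of the weak limit -/

/-- Linear combinations of the values of the fluctuation field are normalized centred sums. -/
lemma sum_mul_fluctuation {d : ℕ} {E D : Set (Euc d)} {Ω Ω₁ : Type*} [MeasurableSpace Ω]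
    {P : Measure Ω} [IsProbabilityMeasure P] {A : Ω → Set (Euc d)}
    (hm : ∀ x : D, MemLp (fun ω => odfOn E D A ω x) 2 P)
    (As : ℕ → Ω₁ → Set (Euc d)) (I : Finset D) (c : D → ℝ) (n : ℕ) (ω : Ω₁) :
    ∑ x ∈ I, c x * fluctuation E D A P As n ω x =
      (Real.sqrt n)⁻¹ * (∑ k ∈ Finset.range n, ∑ x ∈ I, c x * odfOn E D (As k) ω x
        - n * ∫ ω', ∑ x ∈ I, c x * odfOn E D A ω' x ∂P) := by
  rw [integral_finsetSum _ fun x _ => ((hm x).integrable one_le_two).const_mul (c x)]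
  simp_rw [integral_const_mul, fluctuation]
  rw [Finset.sum_comm, Finset.mul_sum, ← Finset.sum_sub_distrib, Finset.mul_sum]
  refine Finset.sum_congr rfl fun x _ => ?_
  rw [← Finset.mul_sum]
  rcases Nat.eq_zero_or_pos n with rfl | hn
  · simp
  have hs : 0 < Real.sqrt n := Real.sqrt_pos.2 (by exact_mod_cast hn)
  have hsq : (n : ℝ) = Real.sqrt n ^ 2 := (Real.sq_sqrt (Nat.cast_nonneg n)).symm
  generalize Real.sqrt n = s at *
  rw [hsq]
  field_simp

section Limit

variable {d : ℕ} {E D : Set (Euc d)} {Ω : Type*} [MeasurableSpace Ω] {P : Measure Ω}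
  [IsProbabilityMeasure P] {A : Ω → Set (Euc d)}
  {Ω' : Type*} [MeasurableSpace Ω'] {P' : Measure Ω'} [IsProbabilityMeasure P']
  {Ω₁ : Type*} [MeasurableSpace Ω₁] {P₁ : Measure Ω₁} [IsProbabilityMeasure P₁]

/-- Linear combinations of the values of a weak limit of the fluctuation field are Gaussian. -/
lemma map_sum_limit_eq_gaussianReal
    (hm : ∀ x : D, MemLp (fun ω => odfOn E D A ω x) 2 P)
    {As : ℕ → Ω₁ → Set (Euc d)} (hAs : IsIIDSample E D A P As P₁)
    {Zn : ℕ → Ω₁ → C(D, ℝ)} (hZn : ∀ n ω x, Zn n ω x = fluctuation E D A P As n ω x)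
    {Z : Ω' → C(D, ℝ)} (hZ : TendstoInDistribution Zn atTop Z (fun _ => P₁) P')
    (I : Finset D) (c : D → ℝ) :
    P'.map (fun ω => ∑ x ∈ I, c x * Z ω x) =
      gaussianReal 0 (Var[fun ω => ∑ x ∈ I, c x * odfOn E D A ω x; P]).toNNReal := by
  set u : (D → ℝ) → ℝ := fun f => ∑ x ∈ I, c x * f x with hu_def
  have hu : Measurable u := by fun_prop
  set X : ℕ → Ω₁ → ℝ := fun k ω => u (odfOn E D (As k) ω) with hX_def
  have hid : ∀ k, IdentDistrib (X k) (fun ω => u (odfOn E D A ω)) P₁ P := fun k =>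
    (hAs.identDistrib k).comp hu
  have hmem : MemLp (fun ω => u (odfOn E D A ω)) 2 P :=
    memLp_finsetSum I fun x _ => (hm x).const_mul (c x)
  have hclt := tendstoInDistribution_inv_sqrt_mul_sum_sub (P := P₁) (X := X)
    (Y := id) (P' := gaussianReal 0 (Var[X 0; P₁]).toNNReal) HasLaw.id
    ((hid 0).memLp_iff.2 hmem) (hAs.indep.comp (fun _ => u) fun _ => hu)
    (fun i => (hid i).trans (hid 0).symm)
  have hcont : Continuous fun f : C(D, ℝ) => ∑ x ∈ I, c x * f x := by fun_prop
  have hlim := hZ.continuous_comp hcont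
  have heq : (fun n => (fun f : C(D, ℝ) => ∑ x ∈ I, c x * f x) ∘ Zn n) =
      fun (n : ℕ) ω => (Real.sqrt n)⁻¹ * (∑ k ∈ Finset.range n, X k ω - n * P₁[X 0]) := by
    funext n ω
    rw [(hid 0).integral_eq]
    simp only [Function.comp, hZn]
    exact sum_mul_fluctuation hm As I c n ω
  rw [heq] at hlim
  have := tendstoInDistribution_unique _ hlim hclt
  rw [Measure.map_id, (hid 0).variance_eq] at this
  exact this

/-- Cramér–Wold: the laws of all finite linear combinations determine joint Gaussianity and the
mean. Covariances follow by polarization from the variance of `Z x + Z y`. -/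
lemma isLimitField_of_tendstoInDistribution
    (hm : ∀ x : D, MemLp (fun ω => odfOn E D A ω x) 2 P)
    {As : ℕ → Ω₁ → Set (Euc d)} (hAs : IsIIDSample E D A P As P₁)
    {Zn : ℕ → Ω₁ → C(D, ℝ)} (hZn : ∀ n ω x, Zn n ω x = fluctuation E D A P As n ω x)
    {Z : Ω' → C(D, ℝ)} (hZ : TendstoInDistribution Zn atTop Z (fun _ => P₁) P') :
    IsLimitField E D A P (fun x ω => Z ω x) P' := by
  classical
  have hlaw := map_sum_limit_eq_gaussianReal hm hAs hZn hZ
  have hZm : ∀ x : D, AEMeasurable (fun ω => Z ω x) P' := fun x =>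
    (continuous_eval_const (F := C(D, ℝ)) x).measurable.comp_aemeasurable hZ.aemeasurable_limit
  have hgauss : IsGaussianProcess (fun (x : D) ω => Z ω x) P' := by
    refine ⟨fun I => ⟨⟨fun L => ?_⟩⟩⟩
    have hIm : AEMeasurable (fun ω => I.restrict fun x => Z ω x) P' :=
      aemeasurable_pi_lambda _ fun i => hZm i
    -- The coefficients of `L` are its values on the standard basis of `I → ℝ`, extended by zero to
    -- all of `D`.
    set c : D → ℝ := fun x =>
      if h : x ∈ I then L (fun j => if ⟨x, h⟩ = j then 1 else 0) else 0 with hc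
    have hL : (L ∘ fun ω => I.restrict fun x => Z ω x) = fun ω => ∑ x ∈ I, c x * Z ω x := by
      funext ω
      rw [← Finset.sum_coe_sort I]
      have := L.toLinearMap.pi_apply_eq_sum_univ (I.restrict fun x => Z ω x)
      simp only [ContinuousLinearMap.coe_coe] at this
      rw [Function.comp, this]
      refine Finset.sum_congr rfl fun i _ => ?_
      simp [hc, mul_comm]
    have hLc : Measurable L := L.continuous.measurable
    have h1 : (P'.map fun ω => I.restrict fun x => Z ω x).map L =
        gaussianReal 0 (Var[fun ω => ∑ x ∈ I, c x * odfOn E D A ω x; P]).toNNReal := by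
      rw [AEMeasurable.map_map_of_aemeasurable hLc.aemeasurable hIm, hL, hlaw I c]
    set ν := P'.map fun ω => I.restrict fun x => Z ω x with hν
    have h2 : ν[L] = 0 := by
      have := integral_map (μ := ν) hLc.aemeasurable (f := fun x : ℝ => x)
        aestronglyMeasurable_id
      rw [← this, h1, integral_id_gaussianReal]
    have h3 : Var[L; ν] = ((Var[fun ω => ∑ x ∈ I, c x * odfOn E D A ω x; P]).toNNReal : ℝ) := by
      rw [← variance_id_map hLc.aemeasurable, h1, variance_id_gaussianReal]
    rw [h1, h2, h3, Real.toNNReal_coe]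
  have hZ2 : ∀ x : D, MemLp (fun ω => Z ω x) 2 P' := fun x =>
    (hgauss.hasGaussianLaw_eval x).memLp_two
  have hvar : ∀ (I : Finset D) (c : D → ℝ), Var[fun ω => ∑ x ∈ I, c x * Z ω x; P'] =
      Var[fun ω => ∑ x ∈ I, c x * odfOn E D A ω x; P] := fun I c => by
    have hmeas : AEMeasurable (fun ω => ∑ x ∈ I, c x * Z ω x) P' :=
      Finset.aemeasurable_fun_sum _ fun x _ => (hZm x).const_mul (c x)
    rw [← variance_id_map hmeas, hlaw I c, variance_id_gaussianReal,
      Real.coe_toNNReal _ (variance_nonneg _ _)]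
  have hvar1 : ∀ x : D, Var[fun ω => Z ω x; P'] = Var[fun ω => odfOn E D A ω x; P] := fun x => by
    simpa using hvar {x} 1
  refine ⟨hgauss, fun x => ?_, fun x y => ?_⟩
  · have h1 := hlaw {x} 1
    simp only [Finset.sum_singleton, Pi.one_apply, one_mul] at h1
    have := integral_map (hZm x) (f := fun x : ℝ => x) aestronglyMeasurable_id
    rw [← this, h1, integral_id_gaussianReal]
  · rw [show (∫ ω, odfOn E D A ω x * odfOn E D A ω y ∂P
      - (∫ ω, odfOn E D A ω x ∂P) * ∫ ω, odfOn E D A ω y ∂P) =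
      cov[fun ω => odfOn E D A ω x, fun ω => odfOn E D A ω y; P] from
      (covariance_eq_sub (hm x) (hm y)).symm]
    rcases eq_or_ne x y with rfl | hxy
    · rw [covariance_self (hZm x), covariance_self (hm x).aemeasurable, hvar1]
    · have h := hvar {x, y} 1
      simp only [Finset.sum_pair hxy, Pi.one_apply, one_mul] at h
      rw [variance_fun_add (hZ2 x) (hZ2 y), variance_fun_add (hm x) (hm y), hvar1, hvar1] at h
      linarith

end Limit

lemma IsLimitField.memLp_two {d : ℕ} {E D : Set (Euc d)} {Ω Ω' : Type*} [MeasurableSpace Ω]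
    {P : Measure Ω} {A : Ω → Set (Euc d)} [MeasurableSpace Ω'] {P' : Measure Ω'}
    {Z : D → Ω' → ℝ} (hZ : IsLimitField E D A P Z P') (x : D) : MemLp (Z x) 2 P' :=
  (hZ.isGaussian.hasGaussianLaw_eval x).memLp_two

/-! ### Covariance bounds for the increments of the limit field -/

section Increments

variable {d : ℕ} {E D : Set (Euc d)} {Ω : Type*} [MeasurableSpace Ω] {P : Measure Ω}
  [IsProbabilityMeasure P] {A : Ω → Set (Euc d)}
  {Ω' : Type*} [MeasurableSpace Ω'] {P' : Measure Ω'} [IsProbabilityMeasure P']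
  {Z : D → Ω' → ℝ}

lemma IsLimitField.covariance_sub_sub (hZ : IsLimitField E D A P Z P')
    (hm : ∀ x : D, MemLp (fun ω => odfOn E D A ω x) 2 P) (x y x' y' : D) :
    cov[fun ω => Z y ω - Z x ω, fun ω => Z y' ω - Z x' ω; P'] =
      cov[fun ω => odfOn E D A ω y - odfOn E D A ω x,
        fun ω => odfOn E D A ω y' - odfOn E D A ω x'; P] := by
  have h : ∀ x y, cov[Z x, Z y; P'] =
      cov[fun ω => odfOn E D A ω x, fun ω => odfOn E D A ω y; P] := fun x y =>
    (hZ.covariance_eq x y).trans (covariance_eq_sub (hm x) (hm y)).symm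
  rw [covariance_fun_sub_fun_sub (hm y) (hm x) (hm y') (hm x'), ← h, ← h, ← h, ← h]
  exact covariance_fun_sub_fun_sub (hZ.memLp_two y) (hZ.memLp_two x) (hZ.memLp_two y')
    (hZ.memLp_two x')

lemma IsLimitField.variance_sub_le (hZ : IsLimitField E D A P Z P') (hE : Convex ℝ E)
    (hDE : D ⊆ E) (hA : IsRandomClosedSet A)
    (hm : ∀ x : D, MemLp (fun ω => odfOn E D A ω x) 2 P) (x y : D) :
    Var[fun ω => Z x ω - Z y ω; P'] ≤ dist x y ^ 2 := by
  have h1 : AEMeasurable (fun ω => Z x ω - Z y ω) P' :=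
    ((hZ.memLp_two x).sub (hZ.memLp_two y)).aemeasurable
  have h2 : AEMeasurable (fun ω => odfOn E D A ω x - odfOn E D A ω y) P :=
    ((hm x).sub (hm y)).aemeasurable
  rw [← covariance_self h1, hZ.covariance_sub_sub hm, covariance_self h2]
  exact variance_odfOn_sub_odfOn_le hE hDE hA x y

/-- Each of the terms `E[UV]` and `E[U] E[V]` is at most `a * b` in absolute value, whence the
factor 2. -/
lemma abs_covariance_le_of_abs_le {U V : Ω → ℝ} (hU : MemLp U 2 P) (hV : MemLp V 2 P) {a b : ℝ}
    (ha : ∀ ω, |U ω| ≤ a) (hb : ∀ ω, |V ω| ≤ b) : |cov[U, V; P]| ≤ 2 * a * b := by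
  obtain ⟨ω₀⟩ := nonempty_of_isProbabilityMeasure P
  have ha0 : 0 ≤ a := (abs_nonneg _).trans (ha ω₀)
  have h1 : |∫ ω, U ω ∂P| ≤ a := by
    simpa using norm_integral_le_of_norm_le_const (f := U) (μ := P) (.of_forall ha)
  have h2 : |∫ ω, V ω ∂P| ≤ b := by
    simpa using norm_integral_le_of_norm_le_const (f := V) (μ := P) (.of_forall hb)
  have h3 : |∫ ω, U ω * V ω ∂P| ≤ a * b := by
    have h : ∀ ω, ‖U ω * V ω‖ ≤ a * b := fun ω => by
      rw [norm_mul]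
      exact mul_le_mul (ha ω) (hb ω) (abs_nonneg _) ha0
    simpa using norm_integral_le_of_norm_le_const (μ := P) (.of_forall h)
  have h4 : |(∫ ω, U ω ∂P) * ∫ ω, V ω ∂P| ≤ a * b := by
    rw [abs_mul]
    exact mul_le_mul h1 h2 (abs_nonneg _) ha0
  rw [covariance_eq_sub hU hV]
  refine (abs_sub _ _).trans ?_
  simp only [Pi.mul_apply]
  linarith

lemma IsLimitField.abs_covariance_sub_sub_le (hZ : IsLimitField E D A P Z P') (hE : Convex ℝ E)
    (hDE : D ⊆ E) (hA : IsRandomClosedSet A)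
    (hm : ∀ x : D, MemLp (fun ω => odfOn E D A ω x) 2 P) (x y x' y' : D) :
    |cov[fun ω => Z y ω - Z x ω, fun ω => Z y' ω - Z x' ω; P']| ≤
      2 * dist y x * dist y' x' := by
  rw [hZ.covariance_sub_sub hm]
  exact abs_covariance_le_of_abs_le ((hm y).sub (hm x)) ((hm y').sub (hm x'))
    (fun ω => abs_odfOn_sub_odfOn_le hE hDE hA ω y x)
    (fun ω => abs_odfOn_sub_odfOn_le hE hDE hA ω y' x')

end Increments

/-! ### Chaining: the deterministic part -/

/-- If `f` has small increments along approximations `π n x → x` from some level on, then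
`f (π n x)` converges, and the limit is Hölder continuous. -/
lemma exists_limit_of_chain {T : Type*} [PseudoMetricSpace T] [DecidableEq T] {f : T → ℝ}
    {π : ℕ → T → T} {F : ℕ → Finset T} (hF : ∀ n x, π n x ∈ F n) (hπ : ∀ n x, dist (π n x) x ≤ (1 / 2) ^ n)
    {α : ℝ} (hα : 0 < α) {N : ℕ}
    (h : ∀ n ≥ N, ∀ s ∈ F n, ∀ t ∈ F n ∪ F (n + 1), dist s t ≤ 3 * (1 / 2) ^ n →
      |f s - f t| ≤ (((1 : ℝ) / 2) ^ α) ^ n) :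
    ∃ g : T → ℝ, (∀ x, Tendsto (fun n => f (π n x)) atTop (𝓝 (g x))) ∧
      ∃ K > 0, ∀ x y, |g x - g y| ≤ K * dist x y ^ α := by
  set ρ : ℝ := ((1 : ℝ) / 2) ^ α with hρ
  have hρ0 : 0 < ρ := by positivity
  have hρ1 : ρ < 1 := Real.rpow_lt_one (by norm_num) (by norm_num) hα
  have hpow : ∀ n : ℕ, ρ ^ n = (((1 : ℝ) / 2) ^ n) ^ α := fun n => by
    rw [hρ, ← Real.rpow_natCast, ← Real.rpow_natCast, ← Real.rpow_mul (by norm_num),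
      ← Real.rpow_mul (by norm_num), mul_comm]
  have hstep : ∀ x, ∀ k, dist (f (π (N + k) x)) (f (π (N + (k + 1)) x)) ≤ ρ ^ N * ρ ^ k :=
    fun x k => by
    rw [Real.dist_eq, ← pow_add]
    refine h (N + k) (Nat.le_add_right _ _) _ (hF _ _) _
      (Finset.mem_union_right _ (hF (N + k + 1) x)) ?_
    rw [← add_assoc]
    have h1 := hπ (N + k) x
    have h2 := hπ (N + k + 1) x
    have h3 := dist_triangle_right (π (N + k) x) (π (N + k + 1) x) x
    have h4 : (0 : ℝ) < (1 / 2) ^ (N + k) := by positivity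
    rw [pow_succ] at h2
    linarith
  choose g hg using fun x =>
    cauchySeq_tendsto_of_complete (cauchySeq_of_le_geometric ρ (ρ ^ N) hρ1 (hstep x))
  have hclose : ∀ n ≥ N, ∀ x, |f (π n x) - g x| ≤ ρ ^ n / (1 - ρ) := fun n hn x => by
    obtain ⟨k, rfl⟩ := Nat.exists_eq_add_of_le hn
    rw [← Real.dist_eq, pow_add]
    exact dist_le_of_le_geometric_of_tendsto ρ (ρ ^ N) hρ1 (hstep x) (hg x) k
  have hlim : ∀ x, Tendsto (fun n => f (π n x)) atTop (𝓝 (g x)) := fun x => by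
    have := hg x
    simp_rw [add_comm N] at this
    exact (tendsto_add_atTop_iff_nat N).1 this
  -- The net at level `N` is finite, so `f` is bounded on it. This controls pairs at distance
  -- greater than `2⁻ᴺ`, for which chaining gives nothing.
  obtain ⟨M, hM⟩ : ∃ M, ∀ x, |f (π N x)| ≤ M := by
    obtain ⟨M, hM⟩ := ((F N).finite_toSet.image fun x => |f x|).bddAbove
    exact ⟨M, fun x => hM ⟨_, hF N x, rfl⟩⟩
  have h1ρ : 0 < 1 - ρ := sub_pos.2 hρ1
  set K₁ : ℝ := ρ⁻¹ * (1 + 2 / (1 - ρ)) with hK₁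
  set K₂ : ℝ := (ρ ^ N)⁻¹ * (2 * |M| + 2 * (ρ ^ N / (1 - ρ))) with hK₂
  have hK₁0 : 0 < K₁ := by positivity
  have hK₂0 : 0 < K₂ := by positivity
  refine ⟨g, hlim, K₁ + K₂, by positivity, fun x y => ?_⟩
  have htri : ∀ n ≥ N, |g x - g y| ≤ |f (π n x) - f (π n y)| + 2 * (ρ ^ n / (1 - ρ)) :=
    fun n hn => by
    have h1 := hclose n hn x
    have h2 := hclose n hn y
    have h3 : g x - g y = (f (π n x) - f (π n y)) - (f (π n x) - g x) + (f (π n y) - g y) := by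
      ring
    rw [h3]
    refine (abs_add_le _ _).trans ?_
    have := abs_sub (f (π n x) - f (π n y)) (f (π n x) - g x)
    linarith
  have hδ0 : 0 ≤ dist x y := dist_nonneg
  have hδα : 0 ≤ dist x y ^ α := Real.rpow_nonneg hδ0 α
  rcases le_or_gt (dist x y) ((1 / 2) ^ N) with hle | hgt
  · suffices |g x - g y| ≤ K₁ * dist x y ^ α from
      this.trans (mul_le_mul_of_nonneg_right (by linarith) hδα)
    have hmain : ∀ n ≥ N, dist x y ≤ (1 / 2) ^ n → |g x - g y| ≤ ρ ^ n * (1 + 2 / (1 - ρ)) :=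
      fun n hn hxy => by
      refine (htri n hn).trans ?_
      have : |f (π n x) - f (π n y)| ≤ ρ ^ n := by
        -- The path from `π n x` through `x` and `y` to `π n y` has three legs of length at most
        -- `2⁻ⁿ`; this is the origin of the factor 3 in the hypothesis.
        refine h n hn _ (hF n x) _ (Finset.mem_union_left _ (hF n y)) ?_
        have h1 := hπ n x
        have h2 := hπ n y
        have h3 := dist_triangle4 (π n x) x y (π n y)
        rw [dist_comm y] at h3
        linarith
      have h4 : ρ ^ n * (1 + 2 / (1 - ρ)) = ρ ^ n + 2 * (ρ ^ n / (1 - ρ)) := by ring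
      linarith
    -- At distance zero the estimate holds at every level and tends to zero; otherwise the level is
    -- chosen with `2^{-(n+1)} < dist x y ≤ 2⁻ⁿ`.
    rcases hδ0.eq_or_lt with h0 | hpos
    · have hz : Tendsto (fun n => ρ ^ n * (1 + 2 / (1 - ρ))) atTop (𝓝 0) := by
        simpa using (tendsto_pow_atTop_nhds_zero_of_lt_one hρ0.le hρ1).mul_const (1 + 2 / (1 - ρ))
      have : |g x - g y| ≤ 0 := ge_of_tendsto hz <| by
        filter_upwards [eventually_ge_atTop N] with n hn
        exact hmain n hn (by rw [← h0]; positivity)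
      exact this.trans (by positivity)
    · obtain ⟨n, hn1, hn2⟩ := exists_nat_pow_near_of_lt_one hpos
        (hle.trans (pow_le_one₀ (by norm_num) (by norm_num))) (by norm_num : (0 : ℝ) < 1 / 2)
        (by norm_num)
      have hnN : N ≤ n := by
        by_contra hcon
        have := pow_le_pow_of_le_one (by norm_num : (0 : ℝ) ≤ 1 / 2) (by norm_num)
          (show n + 1 ≤ N by omega)
        linarith
      refine (hmain n hnN hn2).trans ?_
      have h5 : ρ ^ (n + 1) ≤ dist x y ^ α := by
        rw [hpow]
        exact Real.rpow_le_rpow (by positivity) hn1.le hα.le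
      have h6 : ρ ^ n * (1 + 2 / (1 - ρ)) = K₁ * ρ ^ (n + 1) := by
        rw [hK₁, pow_succ]
        field_simp
      rw [h6]
      exact mul_le_mul_of_nonneg_left h5 hK₁0.le
  · suffices |g x - g y| ≤ K₂ * dist x y ^ α from
      this.trans (mul_le_mul_of_nonneg_right (by linarith) hδα)
    have h5 : ρ ^ N ≤ dist x y ^ α := by
      rw [hpow]
      exact Real.rpow_le_rpow (by positivity) hgt.le hα.le
    have h6 : K₂ * ρ ^ N = 2 * |M| + 2 * (ρ ^ N / (1 - ρ)) := by
      rw [hK₂]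
      field_simp
    refine (htri N le_rfl).trans (le_trans ?_ (mul_le_mul_of_nonneg_left h5 hK₂0.le))
    rw [h6]
    have h7 := abs_sub (f (π N x)) (f (π N y))
    have h8 := hM x
    have h9 := hM y
    have := le_abs_self M
    linarith

/-! ### Finite nets in bounded subsets of Euclidean space -/

/-- Both points lie in one cube of side `1 / (r M)`, whose diameter `√d / (r M)` is at most `1 / r`.
-/
lemma dist_le_of_floor_eq {d M : ℕ} (hM : d ≤ M ^ 2) {r : ℝ} (hr : 0 < r) {x y : Euc d}
    (h : ∀ i, ⌊r * M * x i⌋ = ⌊r * M * y i⌋) : dist x y ≤ r⁻¹ := by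
  rcases Nat.eq_zero_or_pos M with rfl | hM0
  · obtain rfl : d = 0 := by simpa using hM
    rw [Subsingleton.elim x y, dist_self]
    positivity
  have hM0' : (0 : ℝ) < M := by exact_mod_cast hM0
  have hi : ∀ i, dist (x i) (y i) ^ 2 ≤ ((r * M)⁻¹) ^ 2 := fun i => by
    refine pow_le_pow_left₀ dist_nonneg ?_ 2
    have h1 := Int.abs_sub_lt_one_of_floor_eq_floor (h i)
    rw [← mul_sub, abs_mul, abs_of_pos (by positivity)] at h1
    rw [Real.dist_eq, ← one_div, le_div_iff₀ (by positivity), mul_comm]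
    exact h1.le
  rw [EuclideanSpace.dist_eq]
  refine Real.sqrt_le_iff.2 ⟨by positivity, (Finset.sum_le_sum fun i _ => hi i).trans ?_⟩
  rw [Finset.sum_const, Finset.card_univ, Fintype.card_fin, nsmul_eq_mul, mul_inv, mul_pow]
  have h2 : (d : ℝ) ≤ M ^ 2 := by exact_mod_cast hM
  calc (d : ℝ) * (r⁻¹ ^ 2 * (M : ℝ)⁻¹ ^ 2) ≤ M ^ 2 * (r⁻¹ ^ 2 * (M : ℝ)⁻¹ ^ 2) := by gcongr
    _ = r⁻¹ ^ 2 := by field_simp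

/-- A bounded set in `ℝ^d` has `2⁻ⁿ`-nets with at most `C 2^{nd}` elements. -/
lemma exists_finite_nets {d : ℕ} {D : Set (Euc d)} (hD : Bornology.IsBounded D) [Nonempty D] :
    ∃ (C : ℕ) (F : ℕ → Finset D) (π : ℕ → D → D), (∀ n, (F n).card ≤ C * (2 ^ n) ^ d) ∧
      (∀ n x, π n x ∈ F n) ∧ ∀ n x, dist (π n x) x ≤ (1 / 2) ^ n := by
  classical
  obtain ⟨R₀, hR₀⟩ := hD.exists_norm_le
  obtain ⟨R, hR⟩ := exists_nat_ge R₀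
  set M : ℕ := d + 1 with hM
  have hdM : d ≤ M ^ 2 := by nlinarith
  set φ : ℕ → D → Fin d → ℤ := fun n x i => ⌊(2 : ℝ) ^ n * M * (x : Euc d) i⌋ with hφ
  -- `R + 1` in place of `R` ensures `B n ≥ 1`, so that the `2 B n + 1` integers of the interval
  -- number at most `3 B n`.
  set B : ℕ → ℕ := fun n => 2 ^ n * (M * (R + 1)) with hB
  set J : ℕ → Finset (Fin d → ℤ) := fun n =>
    Fintype.piFinset fun _ => Finset.Icc (-(B n : ℤ)) (B n) with hJ
  have hφJ : ∀ n x, φ n x ∈ J n := fun n x => by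
    refine Fintype.mem_piFinset.2 fun i => Finset.mem_Icc.2 ?_
    have h1 : |(x : Euc d) i| ≤ R + 1 := by
      have h2 := PiLp.norm_apply_le (x : Euc d) i
      have h3 := hR₀ x x.2
      rw [Real.norm_eq_abs] at h2
      linarith
    have h2 : |(2 : ℝ) ^ n * M * (x : Euc d) i| ≤ B n := by
      rw [abs_mul, abs_of_nonneg (by positivity), hB]
      push_cast
      rw [mul_assoc]
      gcongr
    obtain ⟨h3, h4⟩ := abs_le.1 h2
    refine ⟨Int.le_floor.2 (by exact_mod_cast h3), ?_⟩
    refine (Int.cast_le (R := ℝ)).1 ?_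
    rw [Int.cast_natCast]
    exact (Int.floor_le ((2 : ℝ) ^ n * M * (x : Euc d) i)).trans h4
  -- The net consists of one representative in `D` for each occupied grid cube, and `π n` sends a
  -- point to the representative of its cube.
  refine ⟨(3 * (M * (R + 1))) ^ d, fun n => (J n).image (Function.invFun (φ n)),
    fun n x => Function.invFun (φ n) (φ n x), fun n => ?_, fun n x => ?_, fun n x => ?_⟩
  · refine Finset.card_image_le.trans ?_
    rw [hJ, Fintype.card_piFinset_const, ← mul_pow, Int.card_Icc]
    refine Nat.pow_le_pow_left ?_ d
    have : 1 ≤ B n := Nat.one_le_iff_ne_zero.2 (by positivity)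
    have h3 : 3 * (M * (R + 1)) * 2 ^ n = 3 * B n := by
      rw [hB]
      ring
    omega
  · exact Finset.mem_image_of_mem _ (hφJ n x)
  · have h : φ n (Function.invFun (φ n) (φ n x)) = φ n x := Function.invFun_eq ⟨x, rfl⟩
    have := dist_le_of_floor_eq hdM (by positivity : (0 : ℝ) < 2 ^ n) fun i => congrFun h i
    rw [one_div, inv_pow]
    exact this

/-! ### Gaussian tails and the almost sure chaining bounds -/

/-- Polynomial tail bounds of all orders for centred Gaussian variables. -/
lemma exists_gaussian_tail_bound (p : ℕ) :
    ∃ C : ℝ, 0 ≤ C ∧ ∀ {Ω : Type*} [MeasurableSpace Ω] {P : Measure Ω} {X : Ω → ℝ},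
      HasGaussianLaw X P → ∫ ω, X ω ∂P = 0 → ∀ {δ : ℝ}, 0 ≤ δ → Var[X; P] ≤ δ ^ 2 →
        ∀ {ε : ℝ}, 0 < ε → P {ω | ε < |X ω|} ≤ ENNReal.ofReal (C * (δ / ε) ^ p) := by
  set γ := gaussianReal 0 1 with hγ
  have hint : Integrable (fun y : ℝ => |y| ^ p) γ := by
    have := (memLp_id_gaussianReal (μ := 0) (v := 1) p).integrable_norm_pow'
    simpa using this
  refine ⟨∫ y, |y| ^ p ∂γ, integral_nonneg fun y => by positivity, ?_⟩
  intro Ω _ P X hX hmean δ hδ hvar ε hε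
  have := hX.isProbabilityMeasure
  set σ : ℝ := Real.sqrt Var[X; P] with hσ
  have hσδ : σ ≤ δ := (Real.sqrt_le_sqrt hvar).trans_eq (Real.sqrt_sq hδ)
  have hσ0 : 0 ≤ σ := Real.sqrt_nonneg _
  -- Writing the law as that of `σ` times a standard normal makes the constant universal and
  -- includes the degenerate case `σ = 0`; the bound is then Markov's inequality for the `p`-th
  -- moment.
  have hlaw : P.map X = γ.map (σ * ·) := by
    rw [hX.map_eq_gaussianReal, hmean, hγ, gaussianReal_map_const_mul]
    congr 1
    · simp
    · ext
      simp [hσ, Real.sq_sqrt (variance_nonneg X P), variance_nonneg X P]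
  have hms : MeasurableSet {y : ℝ | ε < |y|} := measurableSet_lt measurable_const measurable_abs
  have h1 : P {ω | ε < |X ω|} = γ {y | ε < |σ * y|} := by
    have h2 : P.map X {y : ℝ | ε < |y|} = P {ω | ε < |X ω|} :=
      Measure.map_apply_of_aemeasurable hX.aemeasurable hms
    rw [← h2, hlaw, Measure.map_apply (by fun_prop) hms]
    rfl
  have h3 : {y : ℝ | ε < |σ * y|} ⊆ {y | ε ^ p ≤ δ ^ p * |y| ^ p} := fun y hy => by
    simp only [Set.mem_ofPred_eq] at hy ⊢
    rw [← mul_pow]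
    refine pow_le_pow_left₀ hε.le (hy.le.trans ?_) p
    rw [abs_mul, abs_of_nonneg hσ0]
    gcongr
  have h4 := mul_meas_ge_le_integral_of_nonneg (μ := γ) (f := fun y => δ ^ p * |y| ^ p)
    (.of_forall fun y => by positivity) (hint.const_mul _) (ε ^ p)
  rw [integral_const_mul] at h4
  rw [h1]
  refine (measure_mono h3).trans ?_
  rw [← ofReal_measureReal]
  refine ENNReal.ofReal_le_ofReal ?_
  have h5 : (∫ y, |y| ^ p ∂γ) * (δ / ε) ^ p = (δ ^ p * ∫ y, |y| ^ p ∂γ) / ε ^ p := by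
    rw [div_pow]
    ring
  rw [h5, le_div_iff₀ (by positivity), mul_comm]
  exact h4

/-- Tail bounds of all polynomial orders for the increments of `Z`, proportional to the distance. -/
def HasTailBounds {T Ω : Type*} [PseudoMetricSpace T] [MeasurableSpace Ω] (Z : T → Ω → ℝ)
    (P : Measure Ω) : Prop :=
  ∀ p : ℕ, ∃ C : ℝ, 0 ≤ C ∧ ∀ s t, ∀ ε : ℝ, 0 < ε →
    P {ω | ε < |Z s ω - Z t ω|} ≤ ENNReal.ofReal (C * (dist s t / ε) ^ p)

lemma hasTailBounds_of_isGaussianProcess {T Ω : Type*} [PseudoMetricSpace T] [MeasurableSpace Ω]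
    {Z : T → Ω → ℝ} {P : Measure Ω} (hZ : IsGaussianProcess Z P) (hmean : ∀ t, ∫ ω, Z t ω ∂P = 0)
    (hvar : ∀ s t, Var[fun ω => Z s ω - Z t ω; P] ≤ dist s t ^ 2) : HasTailBounds Z P := fun p => by
  obtain ⟨C, hC, h⟩ := exists_gaussian_tail_bound p
  refine ⟨C, hC, fun s t ε hε => h hZ.hasGaussianLaw_fun_sub ?_ dist_nonneg (hvar s t) hε⟩
  rw [integral_sub (hZ.hasGaussianLaw_eval s).integrable (hZ.hasGaussianLaw_eval t).integrable,
    hmean, hmean, sub_zero]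

section Chaining

variable {T Ω : Type*} [PseudoMetricSpace T] [MeasurableSpace Ω] {Z : T → Ω → ℝ} {P : Measure Ω}

/-- Borel–Cantelli with `p = 1`: any threshold decaying geometrically more slowly than `2⁻ⁿ` works,
and `(3/4)ⁿ` leaves probabilities of order `(2/3)ⁿ`. -/
lemma HasTailBounds.ae_tendsto (hZ : HasTailBounds Z P) {u : ℕ → T} {x : T}
    (hu : ∀ n, dist (u n) x ≤ (1 / 2) ^ n) :
    ∀ᵐ ω ∂P, Tendsto (fun n => Z (u n) ω) atTop (𝓝 (Z x ω)) := by
  obtain ⟨C, hC, h⟩ := hZ 1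
  have hsum : (∑' n, P {ω | ((3 : ℝ) / 4) ^ n < |Z (u n) ω - Z x ω|}) ≠ ⊤ := by
    have hs : Summable fun n : ℕ => C * ((2 : ℝ) / 3) ^ n :=
      (summable_geometric_of_lt_one (by norm_num) (by norm_num)).mul_left C
    refine ne_top_of_le_ne_top hs.tsum_ofReal_ne_top (ENNReal.tsum_le_tsum fun n => ?_)
    refine (h _ _ _ (by positivity)).trans (ENNReal.ofReal_le_ofReal ?_)
    rw [pow_one]
    refine mul_le_mul_of_nonneg_left ?_ hC
    rw [div_le_iff₀ (by positivity), ← mul_pow]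
    exact (hu n).trans_eq (by norm_num)
  filter_upwards [ae_eventually_notMem hsum] with ω hω
  rw [tendsto_iff_dist_tendsto_zero]
  refine squeeze_zero' (.of_forall fun n => dist_nonneg) (hω.mono fun n hn => ?_)
    (tendsto_pow_atTop_nhds_zero_of_lt_one (by norm_num : (0 : ℝ) ≤ 3 / 4) (by norm_num))
  rw [Real.dist_eq]
  exact not_lt.1 hn

/-- Along finite sets of exponentially growing cardinality, all small increments are eventually
bounded by `2^{-nα}`, for a fixed order `α`. -/
lemma HasTailBounds.ae_eventually_forall_abs_sub_le [DecidableEq T] (hZ : HasTailBounds Z P)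
    {F : ℕ → Finset T} {C d : ℕ} (hF : ∀ n, (F n).card ≤ C * (2 ^ n) ^ d) {α : ℝ} (hα1 : α < 1) :
    ∀ᵐ ω ∂P, ∀ᶠ n in atTop, ∀ s ∈ F n, ∀ t ∈ F n ∪ F (n + 1), dist s t ≤ 3 * (1 / 2) ^ n →
      |Z s ω - Z t ω| ≤ (((1 : ℝ) / 2) ^ α) ^ n := by
  set ρ : ℝ := ((1 : ℝ) / 2) ^ α with hρ
  have hρ0 : 0 < ρ := by positivity
  have hhalf : 1 / 2 < ρ := by
    have := Real.rpow_lt_rpow_of_exponent_gt (by norm_num : (0 : ℝ) < 1 / 2) (by norm_num) hα1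
    rwa [Real.rpow_one] at this
  set q : ℝ := 1 / 2 / ρ with hq
  have hq0 : 0 < q := by positivity
  have hq1 : q < 1 := (div_lt_one hρ0).2 hhalf
  -- The number of pairs at level `n` grows like `(2^d * 2^d)ⁿ`, while each has probability of order
  -- `(q ^ p)ⁿ`. This `p` makes the product summable.
  obtain ⟨p, hp⟩ := exists_pow_lt_of_lt_one (by positivity : (0 : ℝ) < ((2 : ℝ) ^ d * 2 ^ d)⁻¹) hq1
  obtain ⟨B, hB, h⟩ := hZ p
  set r : ℝ := 2 ^ d * 2 ^ d * q ^ p with hr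
  have hr1 : r < 1 := by
    have := mul_lt_mul_of_pos_left hp (by positivity : (0 : ℝ) < 2 ^ d * 2 ^ d)
    rwa [mul_inv_cancel₀ (by positivity)] at this
  have hr0 : 0 ≤ r := by positivity
  set G : ℕ → Finset (T × T) := fun n =>
    ((F n) ×ˢ (F n ∪ F (n + 1))).filter fun z => dist z.1 z.2 ≤ 3 * (1 / 2) ^ n with hG
  have hGcard : ∀ n, ((G n).card : ℝ) ≤ C * (C + C * 2 ^ d) * (2 ^ d * 2 ^ d) ^ n := fun n => by
    have h1 : (G n).card ≤ (C * (2 ^ n) ^ d) * (C * (2 ^ n) ^ d + C * (2 ^ (n + 1)) ^ d) := by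
      refine (Finset.card_filter_le _ _).trans ?_
      rw [Finset.card_product]
      exact Nat.mul_le_mul (hF n) ((Finset.card_union_le _ _).trans (add_le_add (hF n) (hF _)))
    have h2 : ((G n).card : ℝ) ≤
        (C * (2 ^ n) ^ d) * (C * (2 ^ n) ^ d + C * (2 ^ (n + 1)) ^ d) := by exact_mod_cast h1
    refine h2.trans_eq ?_
    have h3 : ((2 : ℝ) ^ (n + 1)) ^ d = (2 ^ n) ^ d * 2 ^ d := by rw [pow_succ, mul_pow]
    have h4 : ((2 : ℝ) ^ d * 2 ^ d) ^ n = (2 ^ n) ^ d * (2 ^ n) ^ d := by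
      rw [mul_pow, ← pow_mul, ← pow_mul, mul_comm d n]
    rw [h3, h4]
    ring
  set S : ℕ → Set Ω := fun n => ⋃ z ∈ G n, {ω | ρ ^ n < |Z z.1 ω - Z z.2 ω|} with hS
  have hterm : ∀ n, ∀ z ∈ G n, P {ω | ρ ^ n < |Z z.1 ω - Z z.2 ω|} ≤
      ENNReal.ofReal (B * 3 ^ p * (q ^ p) ^ n) := fun n z hz => by
    refine (h z.1 z.2 _ (by positivity)).trans (ENNReal.ofReal_le_ofReal ?_)
    have hd : dist z.1 z.2 ≤ 3 * (1 / 2) ^ n := (Finset.mem_filter.1 hz).2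
    have h1 : dist z.1 z.2 / ρ ^ n ≤ 3 * q ^ n := by
      rw [div_le_iff₀ (by positivity), mul_assoc, ← mul_pow, hq, div_mul_cancel₀ _ hρ0.ne']
      exact hd
    calc B * (dist z.1 z.2 / ρ ^ n) ^ p ≤ B * (3 * q ^ n) ^ p := by gcongr
      _ = B * 3 ^ p * (q ^ p) ^ n := by
        rw [mul_pow, ← pow_mul, ← pow_mul, mul_comm n p]
        ring
  have hSle : ∀ n, P (S n) ≤
      ENNReal.ofReal (C * (C + C * 2 ^ d) * (B * 3 ^ p) * r ^ n) := fun n => by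
    refine (measure_biUnion_finset_le _ _).trans ((Finset.sum_le_sum (hterm n)).trans ?_)
    rw [Finset.sum_const, nsmul_eq_mul, ← ENNReal.ofReal_natCast, ← ENNReal.ofReal_mul
      (Nat.cast_nonneg _)]
    refine ENNReal.ofReal_le_ofReal ?_
    refine (mul_le_mul_of_nonneg_right (hGcard n) (by positivity)).trans_eq ?_
    rw [hr, mul_pow _ (q ^ p)]
    ring
  have hsum : (∑' n, P (S n)) ≠ ⊤ :=
    ne_top_of_le_ne_top
      ((summable_geometric_of_lt_one hr0 hr1).mul_left
        (C * (C + C * 2 ^ d) * (B * 3 ^ p))).tsum_ofReal_ne_top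
      (ENNReal.tsum_le_tsum hSle)
  filter_upwards [ae_eventually_notMem hsum] with ω hω
  filter_upwards [hω] with n hn s hs t ht hst
  by_contra hcon
  exact hn (Set.mem_biUnion (x := (s, t))
    (Finset.mem_coe.2 (Finset.mem_filter.2 ⟨Finset.mem_product.2 ⟨hs, ht⟩, hst⟩)) (not_le.1 hcon))

/-- The bounds of `HasTailBounds.ae_eventually_forall_abs_sub_le` hold almost surely for all orders
simultaneously. -/
lemma HasTailBounds.ae_forall_eventually_forall_abs_sub_le [DecidableEq T]
    (hZ : HasTailBounds Z P) {F : ℕ → Finset T} {C d : ℕ}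
    (hF : ∀ n, (F n).card ≤ C * (2 ^ n) ^ d) :
    ∀ᵐ ω ∂P, ∀ α : ℝ, α < 1 → ∀ᶠ n in atTop, ∀ s ∈ F n, ∀ t ∈ F n ∪ F (n + 1),
      dist s t ≤ 3 * (1 / 2) ^ n → |Z s ω - Z t ω| ≤ (((1 : ℝ) / 2) ^ α) ^ n := by
  -- Countably many orders increasing to 1 suffice, since the bound for a larger order implies the
  -- one for a smaller.
  have h : ∀ᵐ ω ∂P, ∀ k : ℕ, ∀ᶠ n in atTop, ∀ s ∈ F n, ∀ t ∈ F n ∪ F (n + 1),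
      dist s t ≤ 3 * (1 / 2) ^ n →
        |Z s ω - Z t ω| ≤ (((1 : ℝ) / 2) ^ (1 - 1 / ((k : ℝ) + 1))) ^ n :=
    ae_all_iff.2 fun k => hZ.ae_eventually_forall_abs_sub_le hF
      (sub_lt_self _ (by positivity))
  filter_upwards [h] with ω hω α hα
  obtain ⟨k, hk⟩ := exists_nat_one_div_lt (sub_pos.2 hα)
  filter_upwards [hω k] with n hn s hs t ht hst
  refine (hn s hs t ht hst).trans (pow_le_pow_left₀ (by positivity) ?_ n)
  exact Real.rpow_le_rpow_of_exponent_ge (by norm_num) (by norm_num) (by linarith)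

end Chaining

/-! ### Hölder modifications and continuous versions -/

section Modification

variable {d : ℕ} {D : Set (Euc d)} {Ω : Type*} [MeasurableSpace Ω] {Z : D → Ω → ℝ} {P : Measure Ω}

/-- Almost surely, `Z` has a limit along approximating nets, which is Hölder continuous of every
order less than `1`. -/
lemma HasTailBounds.exists_nets_ae_exists_limit (hD : Bornology.IsBounded D) [Nonempty D]
    (hZ : HasTailBounds Z P) :
    ∃ π : ℕ → D → D, (∀ n x, dist (π n x) x ≤ (1 / 2) ^ n) ∧ ∀ᵐ ω ∂P, ∃ g : D → ℝ,
      (∀ x, Tendsto (fun n => Z (π n x) ω) atTop (𝓝 (g x))) ∧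
      ∀ α : ℝ, 0 < α → α < 1 → LipschitzOfOrder α g := by
  classical
  obtain ⟨C, F, π, hF, hπF, hπ⟩ := exists_finite_nets hD
  refine ⟨π, hπ, ?_⟩
  filter_upwards [hZ.ae_forall_eventually_forall_abs_sub_le hF] with ω hω
  have key : ∀ α : ℝ, 0 < α → α < 1 → ∃ g : D → ℝ,
      (∀ x, Tendsto (fun n => Z (π n x) ω) atTop (𝓝 (g x))) ∧
        ∃ K > 0, ∀ x y, |g x - g y| ≤ K * dist x y ^ α := fun α h0 h1 => by
    obtain ⟨N, hN⟩ := eventually_atTop.1 (hω α h1)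
    exact exists_limit_of_chain (f := fun x => Z x ω) hπF hπ h0 hN
  -- The order `1 / 2` is arbitrary: the limit along the nets does not depend on `α`, so one `g`
  -- serves all orders.
  obtain ⟨g, hg, -⟩ := key (1 / 2) (by norm_num) (by norm_num)
  refine ⟨g, hg, fun α h0 h1 => ?_⟩
  obtain ⟨g', hg', K, hK, h⟩ := key α h0 h1
  obtain rfl : g' = g := funext fun x => tendsto_nhds_unique (hg' x) (hg x)
  exact ⟨K, hK, fun x y => by simpa [Subtype.dist_eq, dist_eq_norm] using h x y⟩

lemma HasTailBounds.exists_modification (hD : Bornology.IsBounded D) [Nonempty D]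
    (hZ : HasTailBounds Z P) :
    ∃ Y : D → Ω → ℝ, (∀ x, Y x =ᵐ[P] Z x) ∧
      ∀ ω, ∀ α : ℝ, 0 < α → α < 1 → LipschitzOfOrder α fun x => Y x ω := by
  obtain ⟨π, hπ, h⟩ := hZ.exists_nets_ae_exists_limit hD
  -- The second clause is conditional so that a function can be chosen for every `ω`: the limit
  -- where a regular one exists, zero on the exceptional set.
  have h0 : ∀ ω, ∃ g : D → ℝ, (∀ α : ℝ, 0 < α → α < 1 → LipschitzOfOrder α g) ∧
      ((∃ g : D → ℝ, (∀ x, Tendsto (fun n => Z (π n x) ω) atTop (𝓝 (g x))) ∧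
        ∀ α : ℝ, 0 < α → α < 1 → LipschitzOfOrder α g) →
        ∀ x, Tendsto (fun n => Z (π n x) ω) atTop (𝓝 (g x))) := fun ω => by
    by_cases hω : ∃ g : D → ℝ, (∀ x, Tendsto (fun n => Z (π n x) ω) atTop (𝓝 (g x))) ∧
        ∀ α : ℝ, 0 < α → α < 1 → LipschitzOfOrder α g
    · obtain ⟨g, h1, h2⟩ := hω
      exact ⟨g, h2, fun _ => h1⟩
    · refine ⟨0, fun α _ _ => ⟨1, one_pos, fun x y => ?_⟩, fun h => absurd h hω⟩
      simp only [Pi.zero_apply, sub_self, abs_zero]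
      positivity
  choose g hg1 hg2 using h0
  refine ⟨fun x ω => g ω x, fun x => ?_, hg1⟩
  filter_upwards [h, hZ.ae_tendsto fun n => hπ n x] with ω h1 h2
  exact tendsto_nhds_unique (hg2 ω h1 x) h2

/-- Continuity of a path forces `Z (π n x) ω → Z x ω` at all `x` simultaneously, so the path itself
is the Hölder limit, with no exceptional null set depending on `x`. -/
lemma HasTailBounds.ae_lipschitzOfOrder (hD : Bornology.IsBounded D) [Nonempty D]
    (hZ : HasTailBounds Z P) (hcont : ∀ᵐ ω ∂P, Continuous fun x => Z x ω) :
    ∀ᵐ ω ∂P, ∀ α : ℝ, 0 < α → α < 1 → LipschitzOfOrder α fun x => Z x ω := by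
  obtain ⟨π, hπ, h⟩ := hZ.exists_nets_ae_exists_limit hD
  filter_upwards [h, hcont] with ω ⟨g, hg, hα⟩ hc
  have hlim : ∀ x, Tendsto (fun n => π n x) atTop (𝓝 x) := fun x =>
    tendsto_iff_dist_tendsto_zero.2 (squeeze_zero (fun n => dist_nonneg) (fun n => hπ n x)
      (tendsto_pow_atTop_nhds_zero_of_lt_one (by norm_num) (by norm_num)))
  obtain rfl : g = fun x => Z x ω := funext fun x =>
    tendsto_nhds_unique (hg x) ((hc.tendsto x).comp (hlim x))
  exact hα

end Modification

theorem mainTheorem5 {d : ℕ} (E D : Set (Euc d)) (hE : Convex ℝ E) (hD : IsCompact D)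
    (hDE : D ⊆ E)
    {Ω : Type*} [MeasurableSpace Ω] (P : Measure Ω) [IsProbabilityMeasure P]
    (A : Ω → Set (Euc d)) (hA : IsRandomSetIn E A P)
    (hA2 : ∃ x₀ : D, MemLp (fun ω => odfOn E D A ω x₀) 2 P)
    {Ω' : Type*} [MeasurableSpace Ω'] (P' : Measure Ω') [IsProbabilityMeasure P']
    {Ω₁ : Type*} [MeasurableSpace Ω₁] (P₁ : Measure Ω₁) [IsProbabilityMeasure P₁] :
    -- a weak limit in `C(D)` of the fluctuation fields is the Gaussian field `Z`
    (∀ (As : ℕ → Ω₁ → Set (Euc d)), IsIIDSample E D A P As P₁ →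
      ∀ (Zn : ℕ → Ω₁ → C(D, ℝ)), (∀ n ω x, Zn n ω x = fluctuation E D A P As n ω x) →
      ∀ (Z : Ω' → C(D, ℝ)), TendstoInDistribution Zn atTop Z (fun _ => P₁) P' →
        IsLimitField E D A P (fun x ω => Z ω x) P') ∧
    -- the bounds and the regularity of the paths of `Z`
    (∀ (Z : D → Ω' → ℝ), IsLimitField E D A P Z P' →
      (∀ x y : D, Var[fun ω => Z x ω - Z y ω; P'] ≤ ‖(x : Euc d) - y‖ ^ 2) ∧
      (∀ x y x' y' : D,
        |cov[fun ω => Z y ω - Z x ω, fun ω => Z y' ω - Z x' ω; P']| ≤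
          2 * ‖(y : Euc d) - x‖ * ‖(y' : Euc d) - x'‖) ∧
      ((∀ᵐ ω ∂P', Continuous fun x => Z x ω) →
        ∀ᵐ ω ∂P', ∀ α : ℝ, 0 < α → α < 1 → LipschitzOfOrder α fun x => Z x ω) ∧
      ∃ Y : D → Ω' → ℝ, (∀ x, Y x =ᵐ[P'] Z x) ∧
        ∀ ω, ∀ α : ℝ, 0 < α → α < 1 → LipschitzOfOrder α fun x => Y x ω) := by
  have hrcs := hA.isRandomClosedSet
  have hm := memLp_odfOn hE hDE hrcs hA2
  have : Nonempty D := ⟨hA2.choose⟩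
  refine ⟨fun As hAs Zn hZn Z hZ => isLimitField_of_tendstoInDistribution hm hAs hZn hZ,
    fun Z hZ => ?_⟩
  have hvar := hZ.variance_sub_le hE hDE hrcs hm
  have htail := hasTailBounds_of_isGaussianProcess hZ.isGaussian hZ.mean_zero hvar
  refine ⟨fun x y => ?_, fun x y x' y' => ?_, htail.ae_lipschitzOfOrder hD.isBounded,
    htail.exists_modification hD.isBounded⟩
  · simpa [Subtype.dist_eq, dist_eq_norm] using hvar x y
  · simpa [Subtype.dist_eq, dist_eq_norm] using
      hZ.abs_covariance_sub_sub_le hE hDE hrcs hm x y x' y'
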